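/- Let $F_2=\langle a,b\rangle$ be the free group on two generators, write $\overline{x}=x^{-1}$, let $L_2=\{a,b,\overline a,\overline b\}$, and let $|w|$ be the length of the reduced word of $w\in F_2$. Write $w\sim v$ if $\phi(w)=v$ for some $\phi\in\operatorname{Aut}F_2$; the equivalence classes of $\sim$ are called automorphic conjugacy classes. A word $w$ is *minimal* if $|\phi(w)|\ge|w|$ for all $\phi\in\operatorname{Aut}F_2$. For words $u,w$ with $u$ nonempty, let $(u)_w$ be the number of occurrences of $u$ and $u^{-1}$ as contiguous subwords of $w$ read cyclically, counted by starting position in $w$ (and $(u)_w=0$ if $|u|>|w|$). A cyclically reduced word $w$ is a *root word* if $|(ab)_w-(a\overline b)_w|=(aa)_w=(bb)_w$. An automorphic conjugacy class is a *non-root class* if it contains no root word. Let $J\le\operatorname{Aut}F_2$ be the subgroup generated by the inner automorphisms and the automorphisms that permute $L_2$, and let $[w]$ be the class of $w$ under the action of $J$. A *one-letter automorphism* is an automorphism with $x\mapsto x$, $y\mapsto yx$ for some $x,y\in L_2$ with $y\notin\{x,\overline x\}$. The directed multigraph $\Gamma(W)$ of an automorphic conjugacy class $W$ has as vertices the classes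 $[w]$ of the minimal words $w\in W$, and the number of edges from $[w]$ to $[v]$ is the number of classes $[\phi]$, modulo $\operatorname{Inn}F_2$, of one-letter automorphisms $\phi$ with $\phi(w)\in[v]$ (this does not depend on the representatives). A directed multigraph is *of type (P3)* if, for some $m\ge1$, it is isomorphic to the graph with vertices $1,\dots,m$ which, for $m\ge2$, has exactly one edge from $i$ to $i+1$ for $1\le i<m$, one edge from $i+1$ to $i$ for $1\le i<m-1$, two edges from $m$ to $m-1$, and no others, and which for $m=1$ is a single vertex with two loops. **Corollary.** Let $W$ be a non-root automorphic conjugacy class that contains a minimal word of odd length and is such that $\Gamma(W)$ is of type (P3). Then $\Gamma(W)$ is the degenerate graph of type (P3): it has exactly one vertex, and that vertex has exactly two loops. -/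

import Mathlib

namespace AutConj

/-- The free group on two generators `a` and `b`. -/
abbrev F2 : Type := FreeGroup (Fin 2)

def a : F2 := FreeGroup.of 0

def b : F2 := FreeGroup.of 1

/-- The set of letters `{a, b, a⁻¹, b⁻¹}`. -/
def letters : Set F2 := {a, b, a⁻¹, b⁻¹}

/-- `w ∼ v`: some automorphism of `F2` maps `w` to `v`. -/
def AutEquiv (w v : F2) : Prop := ∃ φ : MulAut F2, φ w = v

/-- `W` is an automorphic conjugacy class, that is, an equivalence class of `∼`. -/
def IsAutClass (W : Set F2) : Prop := ∃ w : F2, W = {v | AutEquiv w v}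

/-- `w` is minimal: no automorphism shortens it (`FreeGroup.norm` is the length of the
reduced word). -/
def IsMinimal (w : F2) : Prop := ∀ φ : MulAut F2, w.norm ≤ (φ w).norm

/-- `(u)_w`: the number of occurrences of `u` and of `u⁻¹` as contiguous subwords of the
cyclic word `w`, counted by their starting positions in `w`. It is `0` if `u` is longer
than `w`. -/
def subwordCount (u w : F2) : ℕ :=
  ((Finset.range w.toWord.length).filter fun i =>
    (w.toWord.rotate i).take u.toWord.length = u.toWord ∨
    (w.toWord.rotate i).take u.toWord.length = u⁻¹.toWord).card

/-- `w` is a root word: it is cyclically reduced and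
`|(ab)_w - (ab⁻¹)_w| = (aa)_w = (bb)_w`. -/
def IsRootWord (w : F2) : Prop :=
  FreeGroup.IsCyclicallyReduced w.toWord ∧
  |(subwordCount (a * b) w : ℤ) - (subwordCount (a * b⁻¹) w : ℤ)| =
    (subwordCount (a * a) w : ℤ) ∧
  subwordCount (a * a) w = subwordCount (b * b) w

/-- A class is a root class if it contains a root word. -/
def IsRootClass (W : Set F2) : Prop := ∃ w ∈ W, IsRootWord w

/-- A permutation (Type I automorphism): an automorphism that permutes the letters. -/
def IsPermutation (φ : MulAut F2) : Prop := φ '' letters = letters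

/-- `φ` is the one-letter automorphism `({y}, x)` for some letters `x`, `y` with
`y ≠ x, x⁻¹`: it fixes `x` and maps `y` to `y x`. -/
def IsOneLetter (φ : MulAut F2) : Prop :=
  ∃ x ∈ letters, ∃ y ∈ letters, y ≠ x ∧ y ≠ x⁻¹ ∧ φ x = x ∧ φ y = y * x

/-- The group of inner automorphisms of `F2`. -/
def Inn : Subgroup (MulAut F2) := (MulAut.conj : F2 →* MulAut F2).range

/-- The subgroup generated by inner automorphisms and permutations. -/
def J : Subgroup (MulAut F2) := Subgroup.closure ((Inn : Set (MulAut F2)) ∪ {φ | IsPermutation φ})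

/-- `w ∼_J v`: some element of `J` maps `w` to `v`. -/
def JEquiv (w v : F2) : Prop := ∃ g ∈ J, g w = v

theorem JEquiv.refl (w : F2) : JEquiv w w := ⟨1, J.one_mem, rfl⟩

theorem JEquiv.symm {w v : F2} : JEquiv w v → JEquiv v w := by
  rintro ⟨g, hg, rfl⟩
  exact ⟨g⁻¹, J.inv_mem hg, by simp⟩

theorem JEquiv.trans {w v u : F2} : JEquiv w v → JEquiv v u → JEquiv w u := by
  rintro ⟨g, hg, rfl⟩ ⟨h, hh, rfl⟩
  exact ⟨h * g, J.mul_mem hh hg, rfl⟩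

instance innNormal : Inn.Normal where
  conj_mem := by
    rintro _ ⟨u, rfl⟩ g
    refine ⟨g u, ?_⟩
    ext v
    simp [MulAut.mul_apply]

/-- The classes `[φ]` modulo `Inn` of one-letter automorphisms `φ` with `φ(w) ∼_J v`. -/
def edgeSet (w v : F2) : Set (MulAut F2 ⧸ Inn) :=
  {c | ∃ φ : MulAut F2, IsOneLetter φ ∧ (φ : MulAut F2 ⧸ Inn) = c ∧ JEquiv (φ w) v}

theorem IsOneLetter.conj_perm {φ π : MulAut F2} (hφ : IsOneLetter φ) (hπ : IsPermutation π) :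
    IsOneLetter (π * φ * π⁻¹) := by
  obtain ⟨x, hx, y, hy, h1, h2, h3, h4⟩ := hφ
  refine ⟨π x, hπ ▸ Set.mem_image_of_mem _ hx, π y, hπ ▸ Set.mem_image_of_mem _ hy, ?_, ?_, ?_, ?_⟩
  · simpa using h1
  · exact fun h => h2 (π.injective (by rw [h, map_inv]))
  · simp [MulAut.mul_apply, h3]
  · simp [MulAut.mul_apply, h4]

theorem IsPermutation.inv {π : MulAut F2} (hπ : IsPermutation π) : IsPermutation π⁻¹ := by
  unfold IsPermutation
  conv_lhs => rw [← hπ, Set.image_image]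
  simp

theorem IsOneLetter.conj_J {g : MulAut F2} (hg : g ∈ J) :
    ∀ φ : MulAut F2, IsOneLetter φ →
      ∃ ψ : MulAut F2, IsOneLetter ψ ∧
        (ψ : MulAut F2 ⧸ Inn) = (g : MulAut F2 ⧸ Inn) * φ * (g : MulAut F2 ⧸ Inn)⁻¹ := by
  have key : ∀ g ∈ ((Inn : Set (MulAut F2)) ∪ {φ | IsPermutation φ}),
      ∀ φ : MulAut F2, IsOneLetter φ → ∃ ψ : MulAut F2, IsOneLetter ψ ∧
        (ψ : MulAut F2 ⧸ Inn) = (g : MulAut F2 ⧸ Inn) * φ * (g : MulAut F2 ⧸ Inn)⁻¹ := by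
    rintro g (hg | hg) φ hφ
    · refine ⟨φ, hφ, ?_⟩
      rw [(QuotientGroup.eq_one_iff g).2 hg]
      simp
    · exact ⟨_, hφ.conj_perm hg, by simp⟩
  have hinv : ∀ g ∈ ((Inn : Set (MulAut F2)) ∪ {φ | IsPermutation φ}),
      g⁻¹ ∈ ((Inn : Set (MulAut F2)) ∪ {φ | IsPermutation φ}) := by
    rintro g (hg | hg)
    · exact Or.inl (Inn.inv_mem hg)
    · exact Or.inr hg.inv
  unfold J at hg
  induction hg using Subgroup.closure_induction'' with
  | mem g hg => exact key g hg
  | inv_mem g hg => exact key g⁻¹ (hinv g hg)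
  | one => exact fun φ hφ => ⟨φ, hφ, by simp⟩
  | mul g h _ _ ihg ihh =>
    intro φ hφ
    obtain ⟨ψ, hψ, e⟩ := ihh φ hφ
    obtain ⟨χ, hχ, e'⟩ := ihg ψ hψ
    exact ⟨χ, hχ, by rw [e', e]; simp [mul_assoc]⟩

theorem edgeSet_conj {w v w' v' : F2} {g : MulAut F2} (hg : g ∈ J) (hw : g w = w')
    (hv : JEquiv v v') {c : MulAut F2 ⧸ Inn} (hc : c ∈ edgeSet w v) :
    (g : MulAut F2 ⧸ Inn) * c * (g : MulAut F2 ⧸ Inn)⁻¹ ∈ edgeSet w' v' := by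
  obtain ⟨φ, hφ, rfl, hφv⟩ := hc
  obtain ⟨ψ, hψ, e⟩ := hφ.conj_J hg
  refine ⟨ψ, hψ, e, ?_⟩
  have e2 : ((g * φ * g⁻¹ * ψ⁻¹ : MulAut F2) : MulAut F2 ⧸ Inn) = 1 := by
    simp [e]
  have hn := (QuotientGroup.eq_one_iff _).1 e2
  have hm : g * φ * g⁻¹ * ψ⁻¹ ∈ J := Subgroup.subset_closure (Or.inl hn)
  have h1 : JEquiv (ψ w') (g (φ w)) := ⟨_, hm, by simp [← hw, MulAut.mul_apply]⟩
  have h2 : JEquiv (φ w) (g (φ w)) := ⟨g, hg, rfl⟩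
  exact h1.trans (h2.symm.trans (hφv.trans hv))

theorem edgeSet_ncard_eq {w v w' v' : F2} (hw : JEquiv w w') (hv : JEquiv v v') :
    (edgeSet w v).ncard = (edgeSet w' v').ncard := by
  obtain ⟨g, hg, hgw⟩ := hw
  have h : edgeSet w' v' = (MulAut.conj (g : MulAut F2 ⧸ Inn)) '' edgeSet w v := by
    ext c
    constructor
    · intro hc
      refine ⟨_, edgeSet_conj (J.inv_mem hg) (by simp [← hgw]) hv.symm hc, ?_⟩
      simp [mul_assoc]
    · rintro ⟨d, hd, rfl⟩
      exact edgeSet_conj hg hgw hv hd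
  rw [h, Set.ncard_image_of_injective _ (MulAut.conj (g : MulAut F2 ⧸ Inn)).injective]

/-- The minimal words in `W`, with the relation `∼_J`. -/
def minimalSetoid (W : Set F2) : Setoid {w : F2 // w ∈ W ∧ IsMinimal w} where
  r w v := JEquiv w v
  iseqv := ⟨fun w => JEquiv.refl w, JEquiv.symm, JEquiv.trans⟩

/-- A directed multigraph, with loops allowed: `edges p q` is the number of edges from `p`
to `q`. -/
structure MultiDigraph where
  V : Type
  edges : V → V → ℕ

/-- The graph `Γ(W)`: its vertices are the minimal words in `W` modulo `∼_J`, and the number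
of edges from `[w]` to `[v]` is the number of classes `[φ]` modulo `Inn` of one-letter
automorphisms with `φ(w) ∈ [v]`. -/
noncomputable def Γ (W : Set F2) : MultiDigraph where
  V := Quotient (minimalSetoid W)
  edges := Quotient.lift₂ (fun w v => (edgeSet w.1 v.1).ncard)
    (fun _ _ _ _ hw hv => edgeSet_ncard_eq hw hv)

/-- Isomorphism of directed multigraphs. -/
def MultiDigraph.IsIso (G H : MultiDigraph) : Prop :=
  ∃ f : G.V ≃ H.V, ∀ p q, H.edges (f p) (f q) = G.edges p q

/-- The double-edged path with `m` vertices `0, …, m - 1`. For `m ≥ 2` there is one edge in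
each direction between consecutive vertices, except that there are two edges from `m - 1`
to `m - 2`; for `m = 1` (the degenerate form) there are two loops at the only vertex. -/
def doubleEdgedPath (m : ℕ) : MultiDigraph where
  V := Fin m
  edges i j :=
    if m = 1 then 2
    else if (i : ℕ) + 1 = j then 1
    else if (j : ℕ) + 1 = i then (if (i : ℕ) + 1 = m then 2 else 1)
    else 0

/-- A graph is of type (P3) if it is a double-edged path with at least one vertex. -/
def IsTypeP3 (G : MultiDigraph) : Prop := ∃ m : ℕ, 1 ≤ m ∧ G.IsIso (doubleEdgedPath m)

end AutConj

/-! ### Cyclically reduced words and conjugacy in a free group. -/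

namespace FreeGroup

variable {α : Type*}

/-! A path of type (P3) with at least two vertices has a double edge between distinct vertices. All
minimal words of a class have the same length, here odd, so it suffices that two distinct edges
between words of odd length force their endpoints to coincide (`jEquiv_of_two_edges`).

Modulo inner automorphisms there are only four one-letter automorphisms: `a ↦ a b^±1` and `b ↦ b
a^±1` (`IsOneLetter.innEq`). Let `(x, y)` be the exponent sums of `w`; `x + y` has the parity of the
length. If the image under `a ↦ a b^±1` is again odd, then `x` is even and `y` odd; for `b ↦ b a^±1`
it is the other way round. Hence two distinct edges are `twist 1` and `twist (-1)`, or the same with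
`a` and `b` exchanged.

Up to conjugation the two images then differ by a permutation `σ` of the letters. Exponent sums
leave only two choices for `σ`. If `σ = 1`, then `twist 2 w` is conjugate to `w`; since the length
of `twist j w` is either unaffected by `j` or unbounded, `twist 1 w` is conjugate to `w`
(`isConj_twist_of_isConj_twist_two`). If `σ` inverts `a`, then `w` is conjugate to its own flip, and
odd length makes it conjugate to a power of `b`, which the twist fixes (`isConj_zpow_of_flipA`).
Either way the edge is a loop. -/

theorem IsCyclicallyReduced.rotate_one {x : α × Bool} {L : List (α × Bool)}
    (h : IsCyclicallyReduced (x :: L)) : IsCyclicallyReduced (L ++ [x]) := by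
  rcases L with _ | ⟨y, L⟩
  · simp
  · obtain ⟨h1, h2⟩ := h
    rw [isReduced_cons_cons] at h1
    refine ⟨?_, ?_⟩
    · rw [IsReduced, List.isChain_append]
      refine ⟨h1.2, by simp, ?_⟩
      intro p hp q hq
      obtain rfl : x = q := by simpa using hq
      exact h2 p (by simpa using hp) x (by simp)
    · intro p hp q hq
      obtain rfl : x = p := by
        rw [List.getLast?_concat] at hp
        simpa using hp
      obtain rfl : y = q := by simpa using hq
      exact h1.1

theorem IsCyclicallyReduced.of_append_head {x : α × Bool} {L : List (α × Bool)}
    (h : IsReduced (x :: L ++ [x])) : IsCyclicallyReduced (x :: L) := by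
  rw [IsReduced, List.isChain_append] at h
  refine ⟨h.1, fun p hp q hq => ?_⟩
  obtain rfl : x = q := by simpa using hq
  exact h.2.2 p hp x (by simp)

theorem IsCyclicallyReduced.rotate_back {x : α × Bool} {L : List (α × Bool)}
    (h : IsCyclicallyReduced (L ++ [x])) : IsCyclicallyReduced (x :: L) := by
  rcases L with _ | ⟨y, L⟩
  · simp
  · apply IsCyclicallyReduced.of_append_head
    have := (isCyclicallyReduced_cons_append_iff.1 h)
    rw [List.cons_append, List.cons_append, isReduced_cons_cons]
    exact ⟨this.2, this.1⟩

theorem norm_pow_of_isCyclicallyReduced [DecidableEq α] {L : List (α × Bool)}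
    (h : IsCyclicallyReduced L) (n : ℕ) : norm (mk L ^ n) = n * L.length := by
  have h1 := (h.flatten_replicate n).isReduced
  rw [norm, toWord_pow, toWord_mk, h.isReduced.reduce_eq, h1.reduce_eq]
  simp

theorem norm_pow_le [DecidableEq α] (x : FreeGroup α) (n : ℕ) : norm (x ^ n) ≤ n * norm x := by
  induction n with
  | zero => simp
  | succ n ih =>
    rw [pow_succ, Nat.succ_mul]
    exact (norm_mul_le _ _).trans (Nat.add_le_add_right ih _)

/-- A cyclically reduced word has minimal length in its conjugacy class. -/
theorem length_le_norm_of_isConj [DecidableEq α] {L : List (α × Bool)}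
    (h : IsCyclicallyReduced L) {x : FreeGroup α} (hx : IsConj (mk L) x) : L.length ≤ norm x := by
  obtain ⟨g, hg⟩ := isConj_iff.1 hx
  by_contra! hlt
  -- Passing to powers makes the cost `2 * norm g` of conjugating independent of `n`, while a strict
  -- gap in length would grow linearly in `n`.
  have key : ∀ n : ℕ, n * L.length ≤ n * norm x + 2 * norm g := by
    intro n
    have e : mk L ^ n = g⁻¹ * x ^ n * g := by
      rw [← hg, conj_pow]; group
    rw [← norm_pow_of_isCyclicallyReduced h, e]
    have h1 := norm_mul_le (g⁻¹ * x ^ n) g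
    have h2 := norm_mul_le g⁻¹ (x ^ n)
    have h3 := norm_pow_le x n
    rw [norm_inv_eq] at h2
    omega
  have := key (2 * norm g + 1)
  nlinarith

theorem exists_isCyclicallyReduced_isConj (x : FreeGroup α) :
    ∃ L : List (α × Bool), IsCyclicallyReduced L ∧ IsConj (mk L) x := by
  classical
  refine ⟨_, reduceCyclically.isCyclicallyReduced (isReduced_toWord (x := x)),
    isConj_iff.2 ⟨mk (reduceCyclically.conjugator x.toWord), ?_⟩⟩
  rw [inv_mk, mul_mk, mul_mk, reduceCyclically.conj_conjugator_reduceCyclically, mk_toWord]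

theorem isReduced_invRev {L : List (α × Bool)} (h : IsReduced L) : IsReduced (invRev L) := by
  classical
  rw [isReduced_iff_reduce_eq, reduce_invRev, h.reduce_eq]

theorem IsReduced.mk_injOn {L M : List (α × Bool)} (hL : IsReduced L) (hM : IsReduced M)
    (h : mk L = mk M) : L = M := by
  classical
  rw [← hL.reduce_eq, ← hM.reduce_eq, reduce.sound h]

/-- Conjugate cyclically reduced words are rotations of each other. -/
theorem IsCyclicallyReduced.isRotated {L M : List (α × Bool)} (hL : IsCyclicallyReduced L)
    (hM : IsCyclicallyReduced M) (h : IsConj (mk L) (mk M)) : L ~r M := by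
  classical
  obtain ⟨g, hg⟩ := isConj_iff.1 h
  -- Induction on the length of the conjugator: if its last letter cancels against either end of
  -- `L`, that letter is absorbed by rotating `L`.
  suffices H : ∀ (n : ℕ) (G : List (α × Bool)) (L : List (α × Bool)), G.length = n → IsReduced G →
      IsCyclicallyReduced L → mk G * mk L * (mk G)⁻¹ = mk M → L ~r M from
    H _ g.toWord L rfl isReduced_toWord hL (by rwa [mk_toWord])
  intro n
  induction n with
  | zero =>
    intro G L hG _ hL e
    rw [List.length_eq_zero_iff] at hG
    subst hG
    have : mk L = mk M := by simpa [← one_eq_mk] using e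
    rw [hL.isReduced.mk_injOn hM.isReduced this]
  | succ n ih =>
    intro G L hGn hG hL e
    obtain ⟨G, x, rfl⟩ : ∃ G' x, G = G' ++ [x] :=
      ⟨_, _, (List.dropLast_append_getLast (List.ne_nil_of_length_eq_add_one hGn)).symm⟩
    have hG' : IsReduced G := hG.infix ⟨[], [x], by simp⟩
    have hn : G.length = n := by simpa using hGn
    rw [← mul_mk] at e
    rcases List.eq_nil_or_concat L with rfl | ⟨L', y, hy⟩
    · have : mk ([] : List (α × Bool)) = mk M := by
        rw [← one_eq_mk, mul_one, mul_inv_cancel] at e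
        rw [← one_eq_mk, e]
      rw [hL.isReduced.mk_injOn hM.isReduced this]
    rcases L with _ | ⟨z, L⟩
    · simp at hy
    by_cases hz : z = (x.1, !x.2)
    · refine List.IsRotated.trans ?_ (ih G (L ++ [z]) hn hG' hL.rotate_one ?_)
      · exact List.IsRotated.cons_append_singleton
      · rw [← e]
        have h1 : mk (z :: L) = mk [z] * mk L := by simp
        have h2 : mk [z] = (mk [x])⁻¹ := by simp [hz, invRev]
        rw [h1, ← mul_mk, h2]
        group
    by_cases hyx : y = x
    · have hcr : IsCyclicallyReduced (x :: L') := by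
        apply IsCyclicallyReduced.rotate_back
        rw [← hyx]
        rwa [hy, List.concat_eq_append] at hL
      have hy' : z :: L = L' ++ [x] := by rw [hy, hyx]; simp
      refine List.IsRotated.trans ?_ (ih G (x :: L') hn hG' hcr ?_)
      · rw [hy']
        exact List.IsRotated.cons_append_singleton.symm
      · rw [← e, hy', ← mul_mk]
        have h1 : mk (x :: L') = mk [x] * mk L' := by simp
        rw [h1]
        group
    -- With no cancellation at either end, `G L G⁻¹` is reduced as written and hence equals `M`; but
    -- its first and last letters are mutually inverse.
    exfalso
    have hy' : z :: L = L' ++ [y] := by rw [hy]; simp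
    have hred1 : IsReduced (G ++ [x] ++ (z :: L)) := by
      rw [IsReduced, List.isChain_append]
      refine ⟨hG, hL.isReduced, ?_⟩
      intro p hp q hq
      obtain rfl : x = p := by simpa using hp
      obtain rfl : z = q := by simpa using hq
      intro h1
      by_contra h2
      apply hz
      ext1
      · exact h1.symm
      · simp only; cases hx2 : x.2 <;> cases hz2 : z.2 <;> simp_all
    have hinv : invRev (G ++ [x]) = (x.1, !x.2) :: invRev G := by simp [invRev]
    have hred2 : IsReduced ((z :: L) ++ invRev (G ++ [x])) := by
      rw [IsReduced, List.isChain_append]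
      refine ⟨hL.isReduced, isReduced_invRev hG, ?_⟩
      intro p hp q hq
      rw [hy'] at hp
      rw [hinv] at hq
      obtain rfl : y = p := by simpa using hp
      obtain rfl : (x.1, !x.2) = q := by simpa using hq
      intro h1
      by_contra h2
      apply hyx
      ext1
      · exact h1
      · simp only at h2; cases hx2 : x.2 <;> cases hz2 : y.2 <;> simp_all
    have hred := hred1.append_overlap hred2 (by simp)
    have hM' : G ++ [x] ++ (z :: L) ++ invRev (G ++ [x]) = M := by
      refine hred.mk_injOn hM.isReduced ?_
      rw [← e, ← mul_mk, ← mul_mk, ← mul_mk, ← inv_mk, ← mul_mk]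
    have hG0 : ∃ y G', G ++ [x] = y :: G' := by
      cases G with
      | nil => exact ⟨x, [], rfl⟩
      | cons y G => exact ⟨y, G ++ [x], rfl⟩
    obtain ⟨y, G', hG0⟩ := hG0
    have hinv' : invRev (y :: G') = invRev G' ++ [(y.1, !y.2)] := by simp [invRev]
    have h3 := hM.2 (y.1, !y.2)
      (by rw [← hM', hG0, hinv', ← List.append_assoc, List.getLast?_concat]; simp) y
      (by rw [← hM', hG0]; simp) rfl
    simp at h3

end FreeGroup

/-! ### The twist `a ↦ a b ^ j` and its action on cyclic syllables. -/

namespace AutConj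

open FreeGroup

/-- The endomorphism `a ↦ a b ^ j`, `b ↦ b`. -/
def twist (j : ℤ) : F2 →* F2 := FreeGroup.lift ![a * b ^ j, b]

@[simp] theorem twist_a (j : ℤ) : twist j a = a * b ^ j := by simp [twist, a]

@[simp] theorem twist_b (j : ℤ) : twist j b = b := by simp [twist, b]

theorem hom_ext {M : Type*} [Monoid M] {f g : F2 →* M} (ha : f a = g a) (hb : f b = g b) :
    f = g := by
  ext i
  fin_cases i
  · exact ha
  · exact hb

theorem twist_twist (j k : ℤ) (w : F2) : twist j (twist k w) = twist (j + k) w := by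
  have : (twist j).comp (twist k) = twist (j + k) := by
    apply hom_ext <;> simp [mul_assoc, zpow_add]
  exact DFunLike.congr_fun this w

/-- A syllable `(e, k)` stands for `a b ^ k` or `a⁻¹ b ^ k`, according to `e`. -/
abbrev Syllable : Type := Bool × ℤ

/-- The element `a` or `a⁻¹`. -/
def aSign (e : Bool) : F2 := mk [(0, e)]

theorem aSign_true : aSign true = a := rfl

theorem aSign_false : aSign false = a⁻¹ := rfl

theorem aSign_mul_not (e : Bool) : aSign e * aSign (!e) = 1 := by
  cases e <;> simp [aSign_true, aSign_false]

def sylProd : List Syllable → F2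
  | [] => 1
  | s :: l => aSign s.1 * b ^ s.2 * sylProd l

theorem sylProd_append (l m : List Syllable) : sylProd (l ++ m) = sylProd l * sylProd m := by
  induction l with
  | nil => simp [sylProd]
  | cons s l ih => simp [sylProd, ih, mul_assoc]

theorem exists_eq_sylProd (w : F2) : ∃ (m : ℤ) (l : List Syllable), w = b ^ m * sylProd l := by
  have key : ∀ L : List (Fin 2 × Bool), ∃ (m : ℤ) (l : List Syllable),
      mk L = b ^ m * sylProd l := by
    intro L
    induction L with
    | nil => exact ⟨0, [], by simp [sylProd, one_eq_mk]⟩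
    | cons x L ih =>
      obtain ⟨m, l, h⟩ := ih
      have hx : mk (x :: L) = mk [x] * mk L := by simp
      rw [hx, h]
      obtain ⟨i, e⟩ := x
      fin_cases i
      · refine ⟨0, (e, m) :: l, ?_⟩
        simp [sylProd, aSign, mul_assoc]
      · cases e
        · refine ⟨-1 + m, l, ?_⟩
          rw [zpow_add, zpow_neg_one, mul_assoc]; rfl
        · refine ⟨1 + m, l, ?_⟩
          rw [zpow_add, zpow_one, mul_assoc]; rfl
  simpa [mk_toWord] using key w.toWord

/-- No cancellation between consecutive syllables. -/
def SylRel (s t : Syllable) : Prop := s.1 ≠ t.1 → s.2 ≠ 0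

theorem isConj_mul_comm (x y : F2) : IsConj (x * y) (y * x) :=
  isConj_iff.2 ⟨y, by group⟩

/-- Every element is conjugate to a power of `b` or to a cyclically reduced product of
syllables. -/
theorem isConj_zpow_or_sylProd (w : F2) : (∃ k : ℤ, IsConj w (b ^ k)) ∨
    ∃ (s : Syllable) (l : List Syllable),
      IsConj w (sylProd (s :: l)) ∧ List.IsChain SylRel (s :: l ++ [s]) := by
  obtain ⟨m, l, rfl⟩ := exists_eq_sylProd w
  induction hn : l.length using Nat.strong_induction_on generalizing m l with
  | _ n ih =>
  have hred : ∀ (w : F2) (k : ℤ) (l' : List Syllable), l'.length < n →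
      IsConj w (b ^ k * sylProd l') → (∃ k : ℤ, IsConj w (b ^ k)) ∨
      ∃ (s : Syllable) (l : List Syllable),
        IsConj w (sylProd (s :: l)) ∧ List.IsChain SylRel (s :: l ++ [s]) := by
    intro w k l' hl hc
    rcases ih _ hl k l' rfl with ⟨k', h⟩ | ⟨s, l, h, h'⟩
    · exact Or.inl ⟨k', hc.trans h⟩
    · exact Or.inr ⟨s, l, hc.trans h, h'⟩
  have main : ∀ (w : F2) (l : List Syllable), l.length = n → IsConj w (sylProd l) →
      (∃ k : ℤ, IsConj w (b ^ k)) ∨ ∃ (s : Syllable) (l : List Syllable),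
        IsConj w (sylProd (s :: l)) ∧ List.IsChain SylRel (s :: l ++ [s]) := by
    intro w l hl hc
    rcases l with _ | ⟨s, l⟩
    · exact Or.inl ⟨0, by simpa [sylProd] using hc⟩
    by_cases hch : List.IsChain SylRel (s :: l ++ [s])
    · exact Or.inr ⟨s, l, hc, hch⟩
    rw [List.isChain_iff_forall_rel_of_append_cons_cons] at hch
    push Not at hch
    obtain ⟨p, q, l1, l2, he, hpq⟩ := hch
    unfold SylRel at hpq
    push Not at hpq
    obtain ⟨hpq, hp0⟩ := hpq
    have hcancel : aSign p.1 * b ^ p.2 * (aSign q.1 * b ^ q.2) = b ^ q.2 := by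
      have : q.1 = !p.1 := by revert hpq; cases p.1 <;> cases q.1 <;> simp
      rw [hp0, this, zpow_zero, mul_one, ← mul_assoc, aSign_mul_not, one_mul]
    -- The cancelling pair either wraps around from the last syllable to the first or lies inside
    -- the word. Both cases conjugate to a word with two syllables fewer and a free power of `b`.
    rcases List.eq_nil_or_concat l2 with rfl | ⟨l2, t, rfl⟩
    · have he' : s :: l ++ [s] = (l1 ++ [p]) ++ [q] := by rw [he]; simp
      obtain ⟨h1, h2⟩ := List.append_inj' he' rfl
      obtain rfl : s = q := by simpa using h2
      rcases l1 with _ | ⟨r, l1⟩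
      · obtain ⟨rfl, -⟩ : s = p ∧ l = [] := by simpa using h1
        exact absurd rfl hpq
      · obtain ⟨rfl, rfl⟩ : s = r ∧ l = l1 ++ [p] := by simpa using h1
        refine hred w s.2 l1 (by simp at hl; omega) (hc.trans ?_)
        have e1 : sylProd (s :: (l1 ++ [p])) =
            aSign s.1 * b ^ s.2 * sylProd l1 * (aSign p.1 * b ^ p.2) := by
          simp [sylProd, sylProd_append, mul_assoc]
        rw [e1]
        refine (isConj_mul_comm _ _).trans ?_
        rw [← mul_assoc, hcancel]
    · have he' : s :: l ++ [s] = (l1 ++ p :: q :: l2) ++ [t] := by rw [he]; simp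
      obtain ⟨h1, -⟩ := List.append_inj' he' rfl
      rw [h1] at hc hl
      refine hred w q.2 (l2 ++ l1) (by simp at hl ⊢; omega) (hc.trans ?_)
      have e1 : sylProd (l1 ++ p :: q :: l2) =
          sylProd l1 * (aSign p.1 * b ^ p.2 * (aSign q.1 * b ^ q.2) * sylProd l2) := by
        simp [sylProd, sylProd_append, mul_assoc]
      rw [e1, hcancel, sylProd_append, ← mul_assoc (b ^ q.2)]
      exact isConj_mul_comm _ _
  rcases List.eq_nil_or_concat l with rfl | ⟨l, t, rfl⟩
  · exact Or.inl ⟨m, by rw [sylProd, mul_one]⟩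
  · refine main _ (l ++ [(t.1, t.2 + m)]) (by simpa using hn) ?_
    have e1 : sylProd (l ++ [(t.1, t.2 + m)]) = sylProd (l ++ [t]) * b ^ m := by
      simp [sylProd, sylProd_append, mul_assoc, zpow_add]
    rw [e1, List.concat_eq_append]
    exact isConj_mul_comm _ _

/-- The reduced word of a syllable. -/
def sylWord (s : Syllable) : List (Fin 2 × Bool) :=
  (0, s.1) :: List.replicate s.2.natAbs (1, decide (0 ≤ s.2))

theorem mk_sylWord (s : Syllable) : mk (sylWord s) = aSign s.1 * b ^ s.2 := by
  obtain ⟨e, k⟩ := s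
  have h1 : mk (sylWord (e, k)) =
      aSign e * mk (List.replicate k.natAbs (1, decide (0 ≤ k))) := by
    simp [sylWord, aSign]
  rw [h1]
  congr 1
  have hp : ∀ (n : ℕ) (c : Bool), mk (List.replicate n ((1 : Fin 2), c)) = mk [(1, c)] ^ n := by
    intro n c
    induction n with
    | zero => rfl
    | succ n ih => rw [pow_succ', ← ih, mul_mk]; rfl
  rw [hp]
  rcases le_or_gt 0 k with hk | hk
  · lift k to ℕ using hk
    simp only [Int.natAbs_natCast, Int.natCast_nonneg, decide_true, zpow_natCast]
    rfl
  · obtain ⟨n, rfl⟩ : ∃ n : ℕ, k = -n := ⟨k.natAbs, by omega⟩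
    have : ¬ (0 ≤ -(n : ℤ)) := by omega
    simp only [this, decide_false, Int.natAbs_neg, Int.natAbs_natCast, zpow_neg, zpow_natCast,
      ← inv_pow]
    rfl

theorem mk_flatMap_sylWord (l : List Syllable) : mk (l.flatMap sylWord) = sylProd l := by
  induction l with
  | nil => rfl
  | cons s l ih => rw [List.flatMap_cons, ← mul_mk, ih, mk_sylWord, sylProd]

theorem isReduced_flatMap_sylWord {l : List Syllable} (h : List.IsChain SylRel l) :
    FreeGroup.IsReduced (l.flatMap sylWord) := by
  rw [FreeGroup.IsReduced, List.flatMap_def, List.isChain_flatten (by simp [sylWord])]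
  refine ⟨?_, ?_⟩
  · intro L hL
    obtain ⟨s, -, rfl⟩ := List.mem_map.1 hL
    rw [sylWord, List.isChain_cons]
    refine ⟨?_, List.isChain_replicate_of_rel _ (by simp)⟩
    intro y hy
    have := List.eq_of_mem_replicate (List.mem_of_mem_head? hy)
    subst this
    simp
  · rw [List.isChain_map]
    refine h.imp ?_
    intro s t hst x hx y hy hxy
    obtain rfl : (0, t.1) = y := by simpa [sylWord] using hy
    rcases eq_or_ne s.2 0 with h0 | h0
    · obtain rfl : (0, s.1) = x := by simpa [sylWord, h0] using hx
      by_contra hne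
      exact hst hne h0
    · obtain ⟨n, hn⟩ := Nat.exists_eq_succ_of_ne_zero (Int.natAbs_ne_zero.2 h0)
      rw [sylWord, hn, List.replicate_succ', ← List.cons_append, List.getLast?_concat] at hx
      obtain rfl : (1, decide (0 ≤ s.2)) = x := by simpa using hx
      simp at hxy

theorem isCyclicallyReduced_flatMap_sylWord {s : Syllable} {l : List Syllable}
    (h : List.IsChain SylRel (s :: l ++ [s])) :
    IsCyclicallyReduced ((s :: l).flatMap sylWord) := by
  have h1 := isReduced_flatMap_sylWord h
  apply IsCyclicallyReduced.of_append_head (x := (0, s.1))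
  refine h1.infix ⟨[], List.replicate s.2.natAbs (1, decide (0 ≤ s.2)), ?_⟩
  simp [sylWord, List.flatMap_def]

/-- The total length of a list of syllables. -/
theorem length_flatMap_sylWord (l : List Syllable) :
    (l.flatMap sylWord).length = (l.map fun s => s.2.natAbs + 1).sum := by
  simp [List.length_flatMap, sylWord]

/-- The increment of the exponent between signs `e` and `e'` under `twist 1`. -/
def signStep : Bool → Bool → ℤ
  | true, true => 1
  | false, false => -1
  | _, _ => 0

/-- The sign of the first syllable, `z` by default. -/
def headSign (z : Bool) : List Syllable → Bool
  | [] => z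
  | s :: _ => s.1

/-- The effect of `twist j` on syllables, `z` being the sign that follows the last one. -/
def sylTwist (j : ℤ) (z : Bool) : List Syllable → List Syllable
  | [] => []
  | s :: l => (s.1, s.2 + j * signStep s.1 (headSign z l)) :: sylTwist j z l

/-- `1` for a negative sign. -/
def negCount : Bool → ℤ
  | true => 0
  | false => 1

/-- Since `a⁻¹ ↦ b ^ (-j) a⁻¹`, each negative syllable passes a factor `b ^ (-j)` to the syllable
before it. The outer powers of `b` are the factors still in transit at the two ends; in the cyclic
word, where `z` is the first sign, they agree and conjugate away. -/
theorem twist_sylProd (j : ℤ) (z : Bool) (l : List Syllable) :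
    twist j (sylProd l) * b ^ (-j * negCount z) =
      b ^ (-j * negCount (headSign z l)) * sylProd (sylTwist j z l) := by
  induction l with
  | nil => simp [sylProd, headSign, sylTwist]
  | cons s l ih =>
    obtain ⟨e, k⟩ := s
    have e1 : twist j (sylProd ((e, k) :: l)) = twist j (aSign e) * b ^ k * twist j (sylProd l) := by
      rw [sylProd, MonoidHom.map_mul, MonoidHom.map_mul, MonoidHom.map_zpow, twist_b]
    rw [e1, mul_assoc, ih]
    simp only [sylProd, sylTwist]
    rw [show headSign z ((e, k) :: l) = e from rfl]
    cases e <;> cases headSign z l <;>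
      simp [aSign_true, aSign_false, negCount, signStep, zpow_add, mul_assoc] <;> group

theorem isConj_twist_sylProd (j : ℤ) (s : Syllable) (l : List Syllable) :
    IsConj (twist j (sylProd (s :: l))) (sylProd (sylTwist j s.1 (s :: l))) := by
  have h := twist_sylProd j s.1 (s :: l)
  simp only [headSign] at h
  refine isConj_iff.2 ⟨(b ^ (-j * negCount s.1))⁻¹, ?_⟩
  rw [inv_inv, mul_assoc, h, inv_mul_cancel_left]

/-- The twist changes an exponent only between equal signs, whereas `SylRel` restricts it only
between opposite signs. The exponent of the final syllable plays no role, so `c` and `c'` are free.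
-/
theorem isChain_sylTwist (j : ℤ) (z : Bool) (c : ℤ) (c' : ℤ) {l : List Syllable}
    (h : List.IsChain SylRel (l ++ [(z, c)])) :
    List.IsChain SylRel (sylTwist j z l ++ [(z, c')]) := by
  induction l with
  | nil => simp [sylTwist]
  | cons s l ih =>
    rcases l with _ | ⟨t, l⟩
    · simp only [sylTwist, headSign, List.cons_append, List.nil_append, List.isChain_cons_cons,
        List.isChain_singleton, and_true] at h ⊢
      intro hne
      have := h hne
      revert hne this
      rcases s with ⟨_ | _, k⟩ <;> cases z <;> simp [signStep]
    · simp only [List.cons_append, List.isChain_cons_cons] at h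
      have := ih h.2
      simp only [sylTwist, headSign, List.cons_append, List.isChain_cons_cons] at this ⊢
      refine ⟨?_, this⟩
      intro hne
      have h1 := h.1 hne
      revert hne h1
      rcases s with ⟨_ | _, k⟩ <;> rcases t with ⟨_ | _, k'⟩ <;> simp [signStep]

/-- One syllable with nonzero step suffices: its exponent `k ± j` has absolute value at least `j -
|k|`. -/
theorem sylTwist_eq_self_or_le (z : Bool) (l : List Syllable) :
    (∀ j, sylTwist j z l = l) ∨ ∃ C : ℤ, ∀ j : ℤ,
      j - C ≤ (((sylTwist j z l).map fun s => s.2.natAbs + 1).sum : ℕ) := by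
  induction l with
  | nil => exact Or.inl fun j => rfl
  | cons s l ih =>
    rcases ih with ih | ⟨C, hC⟩
    · rcases s with ⟨e, k⟩
      by_cases h0 : signStep e (headSign z l) = 0
      · left
        intro j
        simp [sylTwist, h0, ih]
      · right
        refine ⟨|k|, fun j => ?_⟩
        simp only [sylTwist, List.map_cons, List.sum_cons]
        have h1 : signStep e (headSign z l) = 1 ∨ signStep e (headSign z l) = -1 := by
          revert h0; cases e <;> cases headSign z l <;> simp [signStep]
        have := neg_abs_le k
        have := le_abs_self k
        rcases h1 with h1 | h1 <;> rw [h1]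
        · have := le_abs_self (k + j * 1)
          zify; have h3 := Int.natCast_nonneg ((sylTwist j z l).map fun s => s.2.natAbs + 1).sum
          push_cast at h3
          omega
        · have := neg_abs_le (k + j * -1)
          zify; have h3 := Int.natCast_nonneg ((sylTwist j z l).map fun s => s.2.natAbs + 1).sum
          push_cast at h3
          omega
    · right
      refine ⟨C, fun j => (hC j).trans ?_⟩
      simp only [sylTwist, List.map_cons, List.sum_cons]
      push_cast
      have : (0 : ℤ) ≤ |s.2 + j * signStep s.1 (headSign z l)| := abs_nonneg _
      omega

/-- An element conjugate to its image under the square of the twist is conjugate to its image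
under the twist. -/
theorem isConj_twist_of_isConj_twist_two {w : F2} (h : IsConj (twist 2 w) w) :
    IsConj (twist 1 w) w := by
  have hn : ∀ n : ℕ, IsConj (twist (2 * n) w) w := by
    intro n
    induction n with
    | zero =>
      have : twist (2 * (0 : ℕ)) = MonoidHom.id F2 := by apply hom_ext <;> simp
      rw [this]; exact IsConj.refl _
    | succ n ih =>
      have e : twist (2 * (n + 1 : ℕ)) w = twist 2 (twist (2 * n) w) := by
        rw [twist_twist]; congr 2; push_cast; ring
      rw [e]
      exact ((twist 2).map_isConj ih).trans h
  rcases isConj_zpow_or_sylProd w with ⟨k, hk⟩ | ⟨s, l, hw, hch⟩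
  · have := (twist 1).map_isConj hk
    rw [map_zpow, twist_b] at this
    exact this.trans hk.symm
  have hj : ∀ j, IsConj (twist j w) (sylProd (sylTwist j s.1 (s :: l))) := fun j =>
    ((twist j).map_isConj hw).trans (isConj_twist_sylProd j s l)
  rcases sylTwist_eq_self_or_le s.1 (s :: l) with hself | ⟨C, hC⟩
  · have := hj 1
    rw [hself] at this
    exact this.trans hw.symm
  exfalso
  -- The twisted syllables form a cyclically reduced word conjugate to `w`, so they cannot be longer
  -- than `w`, contrary to linear growth.
  have hlen : ∀ n : ℕ, (((sylTwist (2 * n) s.1 (s :: l)).map fun s => s.2.natAbs + 1).sum : ℕ) ≤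
      w.norm := by
    intro n
    rw [← length_flatMap_sylWord]
    apply length_le_norm_of_isConj
    · exact isCyclicallyReduced_flatMap_sylWord (isChain_sylTwist (2 * n) s.1 s.2 _ hch)
    · rw [mk_flatMap_sylWord]
      exact (hj (2 * n)).symm.trans (hn n)
  have h1 := hC (2 * ((w.norm + C.natAbs + 1 : ℕ) : ℤ))
  have h2 := hlen (w.norm + C.natAbs + 1)
  have h3 := h1.trans (Int.ofNat_le.2 h2)
  push_cast at h3
  have := le_abs_self C
  omega

/-! ### Exponent sums and parity of length. -/

/-- The exponent sum of `a`. -/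
def expA : F2 →* Multiplicative ℤ := FreeGroup.lift ![Multiplicative.ofAdd 1, 1]

/-- The exponent sum of `b`. -/
def expB : F2 →* Multiplicative ℤ := FreeGroup.lift ![1, Multiplicative.ofAdd 1]

@[simp] theorem expA_a : expA a = Multiplicative.ofAdd 1 := by simp [expA, a]

@[simp] theorem expA_b : expA b = 1 := by simp [expA, b]

@[simp] theorem expB_a : expB a = 1 := by simp [expB, a]

@[simp] theorem expB_b : expB b = Multiplicative.ofAdd 1 := by simp [expB, b]

theorem toAdd_hom_eq (F : F2 →* Multiplicative ℤ) (w : F2) :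
    (F w).toAdd = (expA w).toAdd * (F a).toAdd + (expB w).toAdd * (F b).toAdd := by
  have : F = (zpowGroupHom (F a).toAdd).comp expA * (zpowGroupHom (F b).toAdd).comp expB := by
    apply hom_ext <;> simp [zpowGroupHom, ← ofAdd_zsmul]
  conv_lhs => rw [this]
  simp [zpowGroupHom, mul_comm]

theorem hom_eq_of_isConj {M : Type*} [CommGroup M] (F : F2 →* M) {w v : F2} (h : IsConj w v) :
    F w = F v :=
  isConj_iff_eq.1 (F.map_isConj h)

/-- Each letter contributes `±1` to the total exponent sum, so parity of length depends only on the
image in the abelianization. -/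
theorem even_length_sub (L : List (Fin 2 × Bool)) :
    Even ((L.length : ℤ) - ((expA (mk L)).toAdd + (expB (mk L)).toAdd)) := by
  induction L with
  | nil => simp [← one_eq_mk]
  | cons x L ih =>
    have h1 : mk (x :: L) = mk [x] * mk L := by simp
    rw [h1, MonoidHom.map_mul, MonoidHom.map_mul, toAdd_mul, toAdd_mul]
    have h2 : Odd ((expA (mk [x])).toAdd + (expB (mk [x])).toAdd) := by
      obtain ⟨i, e⟩ := x
      fin_cases i <;> cases e <;> simp [expA, expB, FreeGroup.lift_mk]
    push_cast [List.length_cons]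
    rw [Int.odd_iff] at h2
    rw [Int.even_iff] at ih ⊢
    omega

/-! ### Odd words conjugate to their image under `a ↦ a⁻¹`. -/

/-- The automorphism `a ↦ a⁻¹`, `b ↦ b` as an endomorphism. -/
def flipA : F2 →* F2 := FreeGroup.lift ![a⁻¹, b]

@[simp] theorem flipA_a : flipA a = a⁻¹ := by simp [flipA, a]

@[simp] theorem flipA_b : flipA b = b := by simp [flipA, b]

def flipLetter (x : Fin 2 × Bool) : Fin 2 × Bool := (x.1, if x.1 = 0 then !x.2 else x.2)

theorem flipLetter_flipLetter (x : Fin 2 × Bool) : flipLetter (flipLetter x) = x := by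
  revert x; decide

theorem flipA_mk (L : List (Fin 2 × Bool)) : flipA (mk L) = mk (L.map flipLetter) := by
  induction L with
  | nil => exact flipA.map_one
  | cons x L ih =>
    have h1 : mk (x :: L) = mk [x] * mk L := by simp
    have h2 : mk ((x :: L).map flipLetter) = mk [flipLetter x] * mk (L.map flipLetter) := by simp
    rw [h1, h2, MonoidHom.map_mul, ih]
    congr 1
    obtain ⟨i, e⟩ := x
    fin_cases i <;> cases e <;> simp [flipA, FreeGroup.lift_mk, flipLetter] <;> rfl

theorem IsCyclicallyReduced.map_flipLetter {L : List (Fin 2 × Bool)}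
    (h : FreeGroup.IsCyclicallyReduced L) :
    FreeGroup.IsCyclicallyReduced (L.map flipLetter) := by
  have key : ∀ x y : Fin 2 × Bool, (x.1 = y.1 → x.2 = y.2) →
      (flipLetter x).1 = (flipLetter y).1 → (flipLetter x).2 = (flipLetter y).2 := by decide
  refine ⟨?_, ?_⟩
  · rw [FreeGroup.IsReduced, List.isChain_map]
    exact List.IsChain.imp (fun x y => key x y) h.1
  · intro p hp q hq
    rw [List.getLast?_map] at hp
    rw [List.head?_map] at hq
    obtain ⟨x, hx, rfl⟩ := Option.mem_map.1 hp
    obtain ⟨y, hy, rfl⟩ := Option.mem_map.1 hq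
    exact key x y (h.2 x hx y hy)

/-- If `f` acts on `L` as rotation by `s`, then iterating `L.length` times gives the trivial
rotation on one side and an odd power of an involution, that is `f`, on the other. -/
theorem map_eq_self_of_isRotated {β : Type*} {f : β → β} (hf : ∀ x, f (f x) = x) {L : List β}
    (hL : Odd L.length) (h : L ~r L.map f) : L.map f = L := by
  obtain ⟨s, hs⟩ := h
  have key : ∀ n : ℕ, L.rotate (n * s) = L.map (f^[n]) := by
    intro n
    induction n with
    | zero => simp
    | succ n ih =>
      rw [Nat.succ_mul, ← List.rotate_rotate, ih, ← List.map_rotate, hs, List.map_map,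
        Function.iterate_succ]
  have h1 := key L.length
  rw [List.rotate_length_mul] at h1
  have h2 : f^[L.length] = f := Function.Involutive.iterate_odd hf hL
  rw [h2] at h1
  exact h1.symm

/-- A cyclically reduced conjugate of `w` is a rotation of its flip; being of odd length it is fixed
letter by letter, so it contains no `a^±1`. -/
theorem isConj_zpow_of_flipA {w : F2} (hodd : Odd ((expA w).toAdd + (expB w).toAdd))
    (h : IsConj (flipA w) w) : ∃ k : ℤ, IsConj w (b ^ k) := by
  obtain ⟨L, hL, hc⟩ := exists_isCyclicallyReduced_isConj w
  have hlen : Odd L.length := by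
    have h1 := even_length_sub L
    rw [hom_eq_of_isConj expA hc, hom_eq_of_isConj expB hc] at h1
    rw [Int.odd_iff] at hodd
    rw [Int.even_iff] at h1
    rw [Nat.odd_iff]
    omega
  have h1 : IsConj (mk L) (mk (L.map flipLetter)) := by
    rw [← flipA_mk]
    exact hc.trans (h.symm.trans (flipA.map_isConj hc.symm))
  have h2 := map_eq_self_of_isRotated flipLetter_flipLetter hlen
    (hL.isRotated (IsCyclicallyReduced.map_flipLetter hL) h1)
  have h3 : ∀ x ∈ L, x.1 = 1 := by
    intro x hx
    have : flipLetter x = x := (List.map_eq_map_iff (g := id)).1 (by simpa using h2) x hx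
    exact (by decide : ∀ x : Fin 2 × Bool, flipLetter x = x → x.1 = 1) x this
  suffices H : ∀ L : List (Fin 2 × Bool), (∀ x ∈ L, x.1 = 1) → ∃ k : ℤ, mk L = b ^ k by
    obtain ⟨k, hk⟩ := H L h3
    exact ⟨k, by rw [← hk]; exact hc.symm⟩
  intro L
  induction L with
  | nil => exact fun _ => ⟨0, rfl⟩
  | cons x L ih =>
    intro hx
    obtain ⟨k, hk⟩ := ih fun y hy => hx y (List.mem_cons_of_mem _ hy)
    have h1 : mk (x :: L) = mk [x] * mk L := by simp
    obtain ⟨i, e⟩ := x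
    obtain rfl : i = 1 := hx _ List.mem_cons_self
    rw [h1, hk]
    cases e
    · exact ⟨-1 + k, by rw [zpow_add, zpow_neg_one]; rfl⟩
    · exact ⟨1 + k, by rw [zpow_add, zpow_one]; rfl⟩

/-! ### Letter permutations and equivalence under `J`. -/

theorem a_ne_b : a ≠ b := fun h => by simpa using congrArg expA h

theorem a_ne_b_inv : a ≠ b⁻¹ := fun h => by simpa using congrArg expA h

theorem IsPermutation.mul {σ τ : MulAut F2} (hσ : IsPermutation σ) (hτ : IsPermutation τ) :
    IsPermutation (σ * τ) := by
  unfold IsPermutation at *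
  have : ⇑(σ * τ) = σ ∘ τ := rfl
  rw [this, Set.image_comp, hτ, hσ]

theorem mem_letters {x : F2} : x ∈ letters ↔ x = a ∨ x = b ∨ x = a⁻¹ ∨ x = b⁻¹ := Iff.rfl

theorem IsPermutation.cases {σ : MulAut F2} (h : IsPermutation σ) :
    ((σ a = a ∨ σ a = a⁻¹) ∧ (σ b = b ∨ σ b = b⁻¹)) ∨
    ((σ a = b ∨ σ a = b⁻¹) ∧ (σ b = a ∨ σ b = a⁻¹)) := by
  have ha : σ a ∈ letters := by
    rw [← h]; exact Set.mem_image_of_mem _ (Or.inl rfl)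
  have hb : σ b ∈ letters := by
    rw [← h]; exact Set.mem_image_of_mem _ (Or.inr (Or.inl rfl))
  have h1 : σ a ≠ σ b := fun e => a_ne_b (σ.injective e)
  have h2 : σ a ≠ (σ b)⁻¹ := fun e => a_ne_b_inv (σ.injective (by rw [e, _root_.map_inv]))
  rcases mem_letters.1 ha with e | e | e | e <;> rcases mem_letters.1 hb with e' | e' | e' | e' <;>
    simp [e, e'] at h1 h2 ⊢

/-- `Inn` is normal, so inner factors can be collected on the left. This reduces `JEquiv` to
conjugacy after one of the eight letter permutations. -/
theorem exists_eq_conj_perm_of_mem_J {g : MulAut F2} (hg : g ∈ J) :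
    ∃ (u : F2) (σ : MulAut F2), IsPermutation σ ∧ g = MulAut.conj u * σ := by
  have hone : IsPermutation 1 := by simp [IsPermutation]
  have key : ∀ g ∈ ((Inn : Set (MulAut F2)) ∪ {φ | IsPermutation φ}),
      ∃ (u : F2) (σ : MulAut F2), IsPermutation σ ∧ g = MulAut.conj u * σ := by
    rintro g (⟨u, rfl⟩ | hg)
    · exact ⟨u, 1, hone, by simp⟩
    · exact ⟨1, g, hg, by simp⟩
  unfold J at hg
  induction hg using Subgroup.closure_induction'' with
  | mem g hg => exact key g hg
  | inv_mem g hg =>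
    refine key g⁻¹ ?_
    rcases hg with hg | hg
    · exact Or.inl (Inn.inv_mem hg)
    · exact Or.inr hg.inv
  | one => exact ⟨1, 1, hone, by simp⟩
  | mul g h _ _ ihg ihh =>
    obtain ⟨u, σ, hσ, rfl⟩ := ihg
    obtain ⟨v, τ, hτ, rfl⟩ := ihh
    refine ⟨u * σ v, σ * τ, hσ.mul hτ, ?_⟩
    ext x
    simp [MulAut.mul_apply, mul_assoc]

theorem JEquiv.of_isConj {w v : F2} (h : IsConj w v) : JEquiv w v := by
  obtain ⟨u, hu⟩ := isConj_iff.1 h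
  exact ⟨MulAut.conj u, Subgroup.subset_closure (Or.inl ⟨u, rfl⟩), by simpa using hu⟩

theorem JEquiv.exists_isConj {w v : F2} (h : JEquiv w v) :
    ∃ σ : MulAut F2, IsPermutation σ ∧ IsConj (σ w) v := by
  obtain ⟨g, hg, rfl⟩ := h
  obtain ⟨u, σ, hσ, rfl⟩ := exists_eq_conj_perm_of_mem_J hg
  exact ⟨σ, hσ, isConj_iff.2 ⟨u, by simp [MulAut.mul_apply]⟩⟩

theorem expA_hom (f : F2 →* F2) (w : F2) : (expA (f w)).toAdd =
    (expA w).toAdd * (expA (f a)).toAdd + (expB w).toAdd * (expA (f b)).toAdd :=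
  toAdd_hom_eq (expA.comp f) w

theorem expB_hom (f : F2 →* F2) (w : F2) : (expB (f w)).toAdd =
    (expA w).toAdd * (expB (f a)).toAdd + (expB w).toAdd * (expB (f b)).toAdd :=
  toAdd_hom_eq (expB.comp f) w

theorem JEquiv.odd_iff {w v : F2} (h : JEquiv w v) :
    Odd ((expA w).toAdd + (expB w).toAdd) ↔ Odd ((expA v).toAdd + (expB v).toAdd) := by
  obtain ⟨σ, hσ, hc⟩ := h.exists_isConj
  rw [← hom_eq_of_isConj expA hc, ← hom_eq_of_isConj expB hc]
  have h1 := expA_hom σ.toMonoidHom w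
  have h2 := expB_hom σ.toMonoidHom w
  simp only [MulEquiv.coe_toMonoidHom] at h1 h2
  rw [h1, h2, Int.odd_iff, Int.odd_iff]
  rcases hσ.cases with ⟨ha | ha, hb | hb⟩ | ⟨ha | ha, hb | hb⟩ <;> simp [ha, hb] <;> omega

theorem odd_norm_iff (w : F2) : Odd w.norm ↔ Odd ((expA w).toAdd + (expB w).toAdd) := by
  have h := even_length_sub w.toWord
  rw [mk_toWord] at h
  rw [Int.even_iff] at h
  rw [FreeGroup.norm, Nat.odd_iff, Int.odd_iff]
  omega

/-! ### Opposite twists with equivalent images. -/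

theorem twist_zero : twist 0 = MonoidHom.id F2 := by
  apply hom_ext <;> simp

theorem isConj_flipA_twist (w : F2) : IsConj (flipA (twist 1 w)) (twist (-1) (flipA w)) := by
  have e : (MulAut.conj b).toMonoidHom.comp (flipA.comp (twist 1)) = (twist (-1)).comp flipA := by
    apply hom_ext <;> simp [mul_assoc]
  exact isConj_iff.2 ⟨b, by simpa using DFunLike.congr_fun e w⟩

theorem jEquiv_twist_self {w : F2} (ha : Even (expA w).toAdd) (hb : Odd (expB w).toAdd)
    (h : JEquiv (twist 1 w) (twist (-1) w)) : JEquiv (twist 1 w) w := by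
  obtain ⟨σ, hσ, hc⟩ := h.exists_isConj
  have h1 := expA_hom σ.toMonoidHom (twist 1 w)
  have h2 := expB_hom σ.toMonoidHom (twist 1 w)
  simp only [MulEquiv.coe_toMonoidHom] at h1 h2
  rw [hom_eq_of_isConj expA hc] at h1
  rw [hom_eq_of_isConj expB hc] at h2
  rw [expA_hom, expA_hom (twist 1), expB_hom (twist 1)] at h1
  rw [expB_hom, expA_hom (twist 1), expB_hom (twist 1)] at h2
  rw [Int.even_iff] at ha
  rw [Int.odd_iff] at hb
  generalize hx : (expA w).toAdd = x at *
  generalize hy : (expB w).toAdd = y at *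
  apply JEquiv.of_isConj
  -- `σ` carries exponent sums `(x, y + x)` to `(x, y - x)`. Inverting `b` would give `y = 0`, and
  -- exchanging the letters would equate the odd `±(y + x)` with the even `x`. Only `σ = 1` and the
  -- flip of `a` survive.
  rcases hσ.cases with ⟨ea | ea, eb | eb⟩ | ⟨ea | ea, eb | eb⟩ <;> simp [ea, eb] at h1 h2
  · have e : σ.toMonoidHom = MonoidHom.id F2 := by apply hom_ext <;> simp [ea, eb]
    have e' : σ (twist 1 w) = twist 1 w := DFunLike.congr_fun e _
    rw [e'] at hc
    have := (twist 1).map_isConj hc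
    rw [twist_twist, twist_twist] at this
    rw [one_add_one_eq_two, add_neg_cancel, twist_zero, MonoidHom.id_apply] at this
    exact isConj_twist_of_isConj_twist_two this
  · omega
  · have e : σ.toMonoidHom = flipA := by apply hom_ext <;> simp [ea, eb]
    have e' : σ (twist 1 w) = flipA (twist 1 w) := DFunLike.congr_fun e _
    rw [e'] at hc
    have := (twist 1).map_isConj ((isConj_flipA_twist w).symm.trans hc)
    rw [twist_twist, twist_twist] at this
    rw [add_neg_cancel, twist_zero, MonoidHom.id_apply, MonoidHom.id_apply] at this
    obtain ⟨k, hk⟩ := isConj_zpow_of_flipA (by rw [hx, hy, Int.odd_iff]; omega) this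
    have h3 := (twist 1).map_isConj hk
    rw [MonoidHom.map_zpow, twist_b] at h3
    exact h3.trans hk.symm
  all_goals omega

/-! ### The same for `b ↦ b a ^ j`, by exchanging the letters. -/

/-- The endomorphism `a ↦ a`, `b ↦ b a ^ j`. -/
def twistB (j : ℤ) : F2 →* F2 := FreeGroup.lift ![a, b * a ^ j]

@[simp] theorem twistB_a (j : ℤ) : twistB j a = a := by simp [twistB, a]

@[simp] theorem twistB_b (j : ℤ) : twistB j b = b * a ^ j := by simp [twistB, b]

/-- The automorphism exchanging `a` and `b`. -/
def swapAB : MulAut F2 := FreeGroup.freeGroupCongr (Equiv.swap 0 1)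

@[simp] theorem swapAB_a : swapAB a = b := by simp [swapAB, a, b]

@[simp] theorem swapAB_b : swapAB b = a := by simp [swapAB, a, b]

theorem isPermutation_swapAB : IsPermutation swapAB := by
  ext x
  simp [letters, Set.image_insert_eq, or_comm, or_left_comm]

theorem jEquiv_swapAB (w : F2) : JEquiv w (swapAB w) :=
  ⟨swapAB, Subgroup.subset_closure (Or.inr isPermutation_swapAB), rfl⟩

theorem twist_swapAB (j : ℤ) (w : F2) : twist j (swapAB w) = swapAB (twistB j w) := by
  have : (twist j).comp swapAB.toMonoidHom = swapAB.toMonoidHom.comp (twistB j) := by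
    apply hom_ext <;> simp
  exact DFunLike.congr_fun this w

theorem jEquiv_twistB_self {w : F2} (ha : Odd (expA w).toAdd) (hb : Even (expB w).toAdd)
    (h : JEquiv (twistB 1 w) (twistB (-1) w)) : JEquiv (twistB 1 w) w := by
  have h1 : JEquiv (twist 1 (swapAB w)) (twist (-1) (swapAB w)) := by
    rw [twist_swapAB, twist_swapAB]
    exact (jEquiv_swapAB _).symm.trans (h.trans (jEquiv_swapAB _))
  have e1 := expA_hom swapAB.toMonoidHom w
  have e2 := expB_hom swapAB.toMonoidHom w
  simp at e1 e2
  have h2 := jEquiv_twist_self (by rw [e1]; simpa using hb) (by rw [e2]; simpa using ha) h1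
  rw [twist_swapAB] at h2
  exact (jEquiv_swapAB _).trans (h2.trans (jEquiv_swapAB _).symm)

/-! ### One-letter automorphisms modulo inner ones, and double edges. -/

/-- `φ` and `f` differ by an inner automorphism. -/
def InnEq (φ : MulAut F2) (f : F2 →* F2) : Prop := ∃ u : F2, ∀ w, φ w = u * f w * u⁻¹

theorem InnEq.isConj {φ : MulAut F2} {f : F2 →* F2} (h : InnEq φ f) (w : F2) :
    IsConj (f w) (φ w) := by
  obtain ⟨u, hu⟩ := h
  exact isConj_iff.2 ⟨u, (hu w).symm⟩

theorem InnEq.coe_eq {φ ψ : MulAut F2} {f : F2 →* F2} (hφ : InnEq φ f) (hψ : InnEq ψ f) :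
    (φ : MulAut F2 ⧸ Inn) = ψ := by
  obtain ⟨u, hu⟩ := hφ
  obtain ⟨v, hv⟩ := hψ
  have e : φ = MulAut.conj (u * v⁻¹) * ψ := by
    ext w
    simp [MulAut.mul_apply, hu, hv, mul_assoc]
  rw [e, QuotientGroup.mk_mul,
    (QuotientGroup.eq_one_iff (N := Inn) (MulAut.conj (u * v⁻¹))).2 ⟨_, rfl⟩, one_mul]

theorem innEq_of {φ : MulAut F2} {f : F2 →* F2} (u : F2) (ha : φ a = u * f a * u⁻¹)
    (hb : φ b = u * f b * u⁻¹) : InnEq φ f := by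
  refine ⟨u, fun w => ?_⟩
  have : φ.toMonoidHom = (MulAut.conj u).toMonoidHom.comp f := by
    apply hom_ext <;> simp [ha, hb]
  simpa using DFunLike.congr_fun this w

/-- The eight choices of `(x, y)` pair up: `y⁻¹ ↦ y⁻¹ x` means `y ↦ x⁻¹ y`, which is conjugate by a
power of `x` to `y ↦ y x⁻¹`. -/
theorem IsOneLetter.innEq {φ : MulAut F2} (h : IsOneLetter φ) :
    (InnEq φ (twist 1) ∨ InnEq φ (twist (-1))) ∨ InnEq φ (twistB 1) ∨ InnEq φ (twistB (-1)) := by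
  obtain ⟨x, hx, y, hy, h1, h2, h3, h4⟩ := h
  rcases mem_letters.1 hx with rfl | rfl | rfl | rfl <;>
    rcases mem_letters.1 hy with rfl | rfl | rfl | rfl <;>
    simp [inv_eq_iff_eq_inv] at h1 h2 h3 h4
  · exact Or.inr (Or.inl (innEq_of 1 (by simp [h3]) (by simp [h4])))
  · exact Or.inr (Or.inr (innEq_of a⁻¹ (by simp [h3]) (by simp [h4, mul_assoc])))
  · exact Or.inl (Or.inl (innEq_of 1 (by simp [h4]) (by simp [h3])))
  · exact Or.inl (Or.inr (innEq_of b⁻¹ (by simp [h4, mul_assoc]) (by simp [h3])))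
  · exact Or.inr (Or.inr (innEq_of 1 (by simp [h3]) (by simp [h4])))
  · exact Or.inr (Or.inl (innEq_of a (by simp [h3]) (by simp [h4, mul_assoc])))
  · exact Or.inl (Or.inr (innEq_of 1 (by simp [h4]) (by simp [h3])))
  · exact Or.inl (Or.inl (innEq_of b (by simp [h4, mul_assoc]) (by simp [h3])))

/-- The twist changes the total exponent sum by `s` times the exponent sum of `a`; parity is
preserved only if the latter is even. -/
theorem even_expA_of_twist {w v : F2} {s : ℤ} (hs : s = 1 ∨ s = -1) (hw : Odd w.norm)
    (hv : Odd v.norm) (h : JEquiv (twist s w) v) :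
    Even (expA w).toAdd ∧ Odd (expB w).toAdd := by
  rw [odd_norm_iff] at hw hv
  rw [← h.odd_iff, expA_hom, expB_hom] at hv
  rw [Int.odd_iff] at *
  rw [Int.even_iff]
  rcases hs with rfl | rfl <;> simp at hv <;> omega

theorem even_expB_of_twistB {w v : F2} {s : ℤ} (hs : s = 1 ∨ s = -1) (hw : Odd w.norm)
    (hv : Odd v.norm) (h : JEquiv (twistB s w) v) :
    Odd (expA w).toAdd ∧ Even (expB w).toAdd := by
  rw [odd_norm_iff] at hw hv
  rw [← h.odd_iff, expA_hom, expB_hom] at hv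
  rw [Int.odd_iff] at *
  rw [Int.even_iff]
  rcases hs with rfl | rfl <;> simp at hv <;> omega

/-- Two distinct edges between words of odd length are loops. -/
theorem jEquiv_of_two_edges {w v : F2} (hw : Odd w.norm) (hv : Odd v.norm)
    {c d : MulAut F2 ⧸ Inn} (hc : c ∈ edgeSet w v) (hd : d ∈ edgeSet w v) (hcd : c ≠ d) :
    JEquiv w v := by
  obtain ⟨φ, hφ, rfl, hφv⟩ := hc
  obtain ⟨ψ, hψ, rfl, hψv⟩ := hd
  have tr : ∀ {χ : MulAut F2} {f : F2 →* F2}, InnEq χ f → JEquiv (χ w) v → JEquiv (f w) v :=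
    fun h h' => (JEquiv.of_isConj (h.isConj w)).trans h'
  have hA : JEquiv (twist 1 w) v → JEquiv (twist (-1) w) v → JEquiv w v := fun h h' =>
    have ⟨h1, h2⟩ := even_expA_of_twist (Or.inl rfl) hw hv h
    (jEquiv_twist_self h1 h2 (h.trans h'.symm)).symm.trans h
  have hB : JEquiv (twistB 1 w) v → JEquiv (twistB (-1) w) v → JEquiv w v := fun h h' =>
    have ⟨h1, h2⟩ := even_expB_of_twistB (Or.inl rfl) hw hv h
    (jEquiv_twistB_self h1 h2 (h.trans h'.symm)).symm.trans h
  -- Edges of the two kinds cannot both leave `w` for `v`: they need opposite parities of the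
  -- exponent sum of `a`.
  have hAB : ∀ {s t : ℤ}, (s = 1 ∨ s = -1) → (t = 1 ∨ t = -1) → JEquiv (twist s w) v →
      JEquiv (twistB t w) v → JEquiv w v := by
    intro s t hs ht h h'
    have h1 := (even_expA_of_twist hs hw hv h).1
    have h2 := (even_expB_of_twistB ht hw hv h').1
    exact absurd h1 (Int.not_even_iff_odd.2 h2)
  rcases hφ.innEq with (h | h) | h | h <;> rcases hψ.innEq with (h' | h') | h' | h' <;>
    have k := tr h hφv <;> have k' := tr h' hψv
  · exact absurd (h.coe_eq h') hcd
  · exact hA k k'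
  · exact hAB (Or.inl rfl) (Or.inl rfl) k k'
  · exact hAB (Or.inl rfl) (Or.inr rfl) k k'
  · exact hA k' k
  · exact absurd (h.coe_eq h') hcd
  · exact hAB (Or.inr rfl) (Or.inl rfl) k k'
  · exact hAB (Or.inr rfl) (Or.inr rfl) k k'
  · exact hAB (Or.inl rfl) (Or.inl rfl) k' k
  · exact hAB (Or.inr rfl) (Or.inl rfl) k' k
  · exact absurd (h.coe_eq h') hcd
  · exact hB k k'
  · exact hAB (Or.inl rfl) (Or.inr rfl) k' k
  · exact hAB (Or.inr rfl) (Or.inr rfl) k' k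
  · exact hB k' k
  · exact absurd (h.coe_eq h') hcd

end AutConj

theorem mainTheorem5 (W : Set AutConj.F2) (hW : AutConj.IsAutClass W)
    (hroot : ¬ AutConj.IsRootClass W)
    (hodd : ∃ w ∈ W, AutConj.IsMinimal w ∧ Odd w.norm)
    (hP3 : AutConj.IsTypeP3 (AutConj.Γ W)) :
    Nat.card (AutConj.Γ W).V = 1 ∧ ∀ v : (AutConj.Γ W).V, (AutConj.Γ W).edges v v = 2 := by
  obtain ⟨m, hm, f, hf⟩ := hP3
  rcases Nat.eq_or_lt_of_le hm with rfl | hm2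
  · refine ⟨?_, fun v => ?_⟩
    · rw [Nat.card_congr f]
      exact Nat.card_fin 1
    · rw [← hf]
      simp [AutConj.doubleEdgedPath]
  exfalso
  obtain ⟨w₀, hw₀W, hw₀min, hw₀odd⟩ := hodd
  obtain ⟨u, rfl⟩ := hW
  -- Minimal words of one class bound each other's length, so the given odd length is the length of
  -- them all.
  have hnorm : ∀ w, AutConj.AutEquiv u w → AutConj.IsMinimal w → Odd w.norm := by
    rintro _ ⟨φ, rfl⟩ hmin
    obtain ⟨ψ, rfl⟩ := hw₀W
    have h1 := hmin (ψ * φ⁻¹)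
    have h2 := hw₀min (φ * ψ⁻¹)
    simp only [MulAut.mul_apply, MulAut.inv_apply_self] at h1 h2
    rwa [le_antisymm h1 h2]
  -- With vertices numbered from `0`, the double edge runs from `m - 1` to `m - 2`.
  let i : (AutConj.doubleEdgedPath m).V := (⟨m - 1, by omega⟩ : Fin m)
  let j : (AutConj.doubleEdgedPath m).V := (⟨m - 2, by omega⟩ : Fin m)
  have hij : f.symm i ≠ f.symm j := by
    intro h
    have := congrArg Fin.val (f.symm.injective h)
    simp only [i, j] at this
    omega
  have hedge : (AutConj.Γ _).edges (f.symm i) (f.symm j) = 2 := by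
    rw [← hf, Equiv.apply_symm_apply, Equiv.apply_symm_apply]
    simp only [AutConj.doubleEdgedPath, i, j]
    rw [if_neg (by omega), if_neg (by omega), if_pos (by omega), if_pos (by omega)]
  obtain ⟨w, hw⟩ := Quotient.exists_rep (f.symm i)
  obtain ⟨v, hv⟩ := Quotient.exists_rep (f.symm j)
  rw [← hw, ← hv] at hedge hij
  have hcard : (AutConj.edgeSet w.1 v.1).ncard = 2 := hedge
  obtain ⟨c, d, hcd, he⟩ := Set.ncard_eq_two.1 hcard
  exact hij (Quotient.sound (AutConj.jEquiv_of_two_edges (hnorm _ w.2.1 w.2.2)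
    (hnorm _ v.2.1 v.2.2) (he ▸ Or.inl rfl) (he ▸ Or.inr rfl) hcd))
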